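/- **Notation.** All hypergraphs are finite. For a $k$-uniform hypergraph $G$ let $E^*(G)$ be the set of all subsets of edges of $G$ (the partial edges). For $Q\subseteq V(G)$ let $PE_Q(G)=\{s\subseteq Q: s\in E^*(G)\}$, and for $E\subseteq E^*(G)$ let $N(E;G)=\{v\in V(G): v\notin e\text{ and } e\cup\{v\}\in E^*(G)\text{ for all }e\in E\}$. For $\theta>0$ and $x\ge 0$ let $\omega_\theta(x)=+\infty$ if $x=0$, $\omega_\theta(x)=\theta/x$ if $0<x<\theta$, and $\omega_\theta(x)=0$ if $x\ge\theta$. For $Q, A\subseteq V(G)$ put $\omega_\theta(Q,A;G)=\omega_\theta(|N(PE_Q(G);G)\cap A|)$. A tuple is also viewed as the set of its coordinates. **Setup.** Let $K\ge k\ge 2$ and $d\ge 1$ be integers. Let $G$ be a $k$-uniform hypergraph without isolated vertices, with a partition $V(G)=V_1\sqcup\dots\sqcup V_K$. Let $H$ be a $k$-uniform hypergraph with a partition $V(H)=W_1\sqcup\dots\sqcup W_K$ such that the vertices of each edge lie in $k$ different parts. For $i<K$ and $x\in W_i$ let $N^+(x)$ be the set of vertices of $W_{i+1}\sqcup\dots\sqcup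 W_K$ that lie in a common edge with $x$. Assume that $|N^+(x)|\le d$, and fix a $d$-tuple $f_x\in(W_{i+1}\sqcup\dots\sqcup W_K)^d$ that consists of the elements of $N^+(x)$ in some order, padded by $d-|N^+(x)|$ further vertices (repetitions are allowed in the padding). Let $\theta_1,\dots,\theta_{K-1}>0$ be real numbers. For $x\in W_i$ with $i<K$ and $f_x\in W_{i_1}\times\dots\times W_{i_d}$ let $$\mu_t(x)=\frac1{|\mathcal Q_x|}\sum_{Q\in\mathcal Q_x}\omega_{\theta_i}(Q,V_i;G)^t,\qquad \mathcal Q_x=V_{i_1}\times\dots\times V_{i_d},$$ with $\mu_t(x)=0$ if $\mathcal Q_x=\emptyset$. For $x\in W_K$ let $\mu_t(x)=0$. Let $\mu_t=\max_{x\in V(H)}\mu_t(x)\in[0,\infty]$ (which is $0$ if $V(H)=\emptyset$) and $\gamma=\max\{1,\max_{i<K}|V_i|/\theta_i\}$. Products in $[0,\infty]$ are taken with $0\cdot\infty=0$. **Random greedy algorithm.** It builds a random map $\psi$ from $V(H)$ to $V(G)$. 1. Order $W_K$ arbitrarily, and map its vertices one after the other, each to a uniform random vertex of $V_K$ that has not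 been used yet. 2. In decreasing order, for each $i<K$: once $\psi$ is defined on $W_{i+1}\sqcup\dots\sqcup W_K$, take an ordering $x_1,\dots,x_{|W_i|}$ of $W_i$ along which $\omega_{\theta_i}(\psi(f_{x_j}),V_i;G)$ is non-increasing. For $j=1,2,\dots$ let $N_j=N(PE_{\psi(f_{x_j})}(G);G)\cap V_i$ and $L_j=N_j\setminus\{\psi(x_1),\dots,\psi(x_{j-1})\}$. Choose $\psi(x_j)$ uniformly at random from $V_i$ if $N_j=\emptyset$; from $N_j$ if $N_j\neq\emptyset$ and $|L_j|<|N_j|/2$; and from $L_j$ otherwise. (If a choice is to be made from an empty set, the vertex is left without an image.) **Theorem.** In this setup, assume that $|V_K|\ge 2|W_K|$, that $\theta_i\ge 2|W_i|$ for all $i<K$, and that $$2^{2d+2}\,\gamma^{2d}\,\mu_{4d}\sum_{i<K}\frac{|W_i|}{\theta_i}<1 .$$ Then there is an embedding of $H$ into $G$, that is, an injective map $V(H)\to V(G)$ that sends every edge of $H$ to an edge of $G$. Moreover, for every choice of the orderings that the random greedy algorithm allows, the algorithm produces an embedding of $H$ into $G$ with positive probability. -/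

import Mathlib

open scoped ENNReal

/-- `E^*(G)`: the partial edges of `G`, i.e. all subsets of edges of `G`. -/
def Hypergraph.partialEdges {U : Type*} (G : Hypergraph U) : Set (Set U) :=
  {e | ∃ f ∈ G.edgeSet, e ⊆ f}

/-- `PE_Q(G)`: the partial edges of `G` contained in `Q`. -/
def Hypergraph.partialEdgesIn {U : Type*} (G : Hypergraph U) (Q : Set U) : Set (Set U) :=
  {s | s ⊆ Q ∧ s ∈ G.partialEdges}

/-- `N(E; G)`: the vertices `v` for which the disjoint union `e ⊔ {v}` is a partial edge of `G`
for every `e ∈ E`. -/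
def Hypergraph.commonNbhd {U : Type*} (G : Hypergraph U) (E : Set (Set U)) : Set U :=
  {v | v ∈ G.vertexSet ∧ ∀ e ∈ E, v ∉ e ∧ insert v e ∈ G.partialEdges}

/-- Every edge has exactly `k` vertices. -/
def Hypergraph.IsUniform {U : Type*} (G : Hypergraph U) (k : ℕ) : Prop :=
  ∀ e ∈ G.edgeSet, e.ncard = k

/-- An embedding of `H` into `G` (hypergraphs whose vertex sets are the whole types): an injective
map of vertices sending edges to edges. -/
def Hypergraph.IsEmbedding {W U : Type*} (H : Hypergraph W) (G : Hypergraph U) (φ : W → U) : Prop :=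
  Function.Injective φ ∧ ∀ e ∈ H.edgeSet, φ '' e ∈ G.edgeSet

/-- The function `ω_θ` on nonnegative reals: `∞` at `0`, `θ / x` for `0 < x < θ`, and `0` for
`x ≥ θ`. -/
noncomputable def omegaFun (θ x : ℝ) : ℝ≥0∞ :=
  if x = 0 then ⊤ else if x < θ then ENNReal.ofReal (θ / x) else 0

/-- A partitioned pair `(G, H)` of `k`-uniform hypergraphs on the finite vertex sets `U` and `W`.
The `K` parts are indexed by `Fin K`, i.e. by `0, …, K - 1` instead of `1, …, K`; "`i < K`" becomes
`(i : ℕ) + 1 < K`, and the last part is the one with `(i : ℕ) + 1 = K`.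
A partition is given by the map sending a vertex to the index of its part. -/
structure PartitionedPair (U W : Type*) [Fintype U] [Fintype W] (k K d : ℕ) where
  two_le_k : 2 ≤ k
  k_le_K : k ≤ K
  one_le_d : 1 ≤ d
  /-- the host hypergraph -/
  G : Hypergraph U
  vertexSet_G : G.vertexSet = Set.univ
  uniform_G : G.IsUniform k
  no_isolated : ∀ u, ¬ G.IsIsolated u
  /-- the index of the part `V_i` containing a vertex of `G` -/
  partG : U → Fin K
  /-- the hypergraph to be embedded -/
  H : Hypergraph W
  vertexSet_H : H.vertexSet = Set.univ
  uniform_H : H.IsUniform k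
  /-- the index of the part `W_i` containing a vertex of `H` -/
  partH : W → Fin K
  edges_crossing : ∀ e ∈ H.edgeSet, Set.InjOn partH e
  /-- `|N^+(x)| ≤ d` for each vertex `x` outside the last part -/
  forward_degree : ∀ x, (partH x : ℕ) + 1 < K → {y | H.Adj x y ∧ partH x < partH y}.ncard ≤ d
  /-- the padded tuple `f_x`; its value is irrelevant for `x` in the last part -/
  f : W → Fin d → W
  f_later : ∀ x, (partH x : ℕ) + 1 < K → ∀ j, partH x < partH (f x j)
  f_covers : ∀ x, (partH x : ℕ) + 1 < K →
    {y | H.Adj x y ∧ partH x < partH y} ⊆ Set.range (f x)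
  /-- the thresholds; the value at the last index is irrelevant -/
  θ : Fin K → ℝ
  θ_pos : ∀ i : Fin K, (i : ℕ) + 1 < K → 0 < θ i

namespace PartitionedPair

variable {U W : Type*} [Fintype U] [Fintype W] {k K d : ℕ} (S : PartitionedPair U W k K d)

/-- The part `V_i` of `G`. -/
def V (i : Fin K) : Finset U := Finset.univ.filter fun u => S.partG u = i

/-- The part `W_i` of `H`. -/
def Wpart (i : Fin K) : Finset W := Finset.univ.filter fun x => S.partH x = i

/-- The indices `i < K`, i.e. all indices but the last. -/
def nonLast (_S : PartitionedPair U W k K d) : Finset (Fin K) :=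
  Finset.univ.filter fun i => (i : ℕ) + 1 < K

open Classical in
/-- `N(PE_Q(G); G) ∩ V_i`. -/
noncomputable def nbhd (Q : Set U) (i : Fin K) : Finset U :=
  (S.V i).filter fun v => v ∈ S.G.commonNbhd (S.G.partialEdgesIn Q)

/-- The defect `ω_{θ_i}(Q, V_i; G)`. -/
noncomputable def defect (Q : Set U) (i : Fin K) : ℝ≥0∞ :=
  omegaFun (S.θ i) ((S.nbhd Q i).card : ℝ)

/-- The average `t`-th power defect `μ_{θ_i, t}(𝒬, V_i; G)` over a set `𝒬` of tuples. -/
noncomputable def avgDefect (t : ℕ) (𝒬 : Finset (Fin d → U)) (i : Fin K) : ℝ≥0∞ :=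
  (∑ q ∈ 𝒬, S.defect (Set.range q) i ^ t) / (𝒬.card : ℝ≥0∞)

/-- `𝒬_x = V_{i_1} × ⋯ × V_{i_d}`, where `f_x ∈ W_{i_1} × ⋯ × W_{i_d}`. -/
def tuples (x : W) : Finset (Fin d → U) :=
  Fintype.piFinset fun j => S.V (S.partH (S.f x j))

/-- `μ_t(x)`; it is `0` for `x` in the last part, where the defect is taken to be `0`. -/
noncomputable def muAt (t : ℕ) (x : W) : ℝ≥0∞ :=
  if (S.partH x : ℕ) + 1 < K then S.avgDefect t (S.tuples x) (S.partH x) else 0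

/-- `μ_t`, the maximum of `μ_t(x)` over the vertices `x` of `H`. -/
noncomputable def mu (t : ℕ) : ℝ≥0∞ := Finset.univ.sup fun x => S.muAt t x

/-- `γ`, the maximum of `1` and the ratios `|V_i| / θ_i` for `i < K`. -/
noncomputable def gamma : ℝ≥0∞ :=
  max 1 (S.nonLast.sup fun i => ((S.V i).card : ℝ≥0∞) / ENNReal.ofReal (S.θ i))

/-! ### The random greedy process

A state is a partial map `ψ : W → Option U`, with value `none` at the vertices not embedded yet. -/

/-- The set `ψ(f_x)` in the state `ψ`. -/
def imageTuple (x : W) (ψ : W → Option U) : Set U := {u | ∃ j, ψ (S.f x j) = some u}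

open Classical in
/-- The images of the vertices of `W_i` that have been embedded so far. -/
noncomputable def used (i : Fin K) (ψ : W → Option U) : Finset U :=
  Finset.univ.filter fun u => ∃ y, S.partH y = i ∧ ψ y = some u

open Classical in
/-- The set from which the image of `x` is chosen uniformly at random in the state `ψ`. In the last
part it is the set of unused vertices of `V_K`. In any other part let `N = N(PE_{ψ(f_x)}(G); G) ∩ V_i`
and let `L` be its set of unused vertices; the set is `V_i` if `N` is empty, `N` if
`|L| < |N| / 2`, and `L` otherwise. -/
noncomputable def choices (x : W) (ψ : W → Option U) : Finset U :=
  let i := S.partH x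
  if (i : ℕ) + 1 < K then
    let N := S.nbhd (S.imageTuple x ψ) i
    let L := N \ S.used i ψ
    if N.card = 0 then S.V i
    else if 2 * L.card < N.card then N
    else L
  else S.V i \ S.used i ψ

open Classical in
/-- Embed the vertex `x` at random. If there is nothing to choose from, `x` stays without image. -/
noncomputable def stepPMF (x : W) (ψ : W → Option U) : PMF (W → Option U) :=
  if h : (S.choices x ψ).Nonempty then
    (PMF.uniformOfFinset (S.choices x ψ) h).map fun u => Function.update ψ x (some u)
  else PMF.pure ψ

/-- Embed the vertices of a list one after the other. -/
noncomputable def listPMF : List W → (W → Option U) → PMF (W → Option U)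
  | [], ψ => PMF.pure ψ
  | x :: l, ψ => (S.stepPMF x ψ).bind (listPMF l)

/-- Embed the parts in a list of indices one after the other, the vertices of `W_i` being taken in
the order `ord i ψ`, where `ψ` is the state when the treatment of `W_i` begins. -/
noncomputable def partsPMF (ord : Fin K → (W → Option U) → List W) :
    List (Fin K) → (W → Option U) → PMF (W → Option U)
  | [], ψ => PMF.pure ψ
  | i :: l, ψ => (S.listPMF (ord i ψ) ψ).bind (partsPMF ord l)

/-- The law of the output of the random greedy process: starting from the nowhere defined map, embed
the parts in decreasing order of their indices. -/
noncomputable def greedyPMF (ord : Fin K → (W → Option U) → List W) : PMF (W → Option U) :=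
  S.partsPMF ord (List.finRange K).reverse fun _ => none

/-- A rule for ordering the parts of `H` that the process may use: `ord i ψ` enumerates `W_i`, and
for `i < K` it does so with non-increasing defects `ω_{θ_i}(ψ(f_x), V_i; G)`. -/
structure IsOrderRule (ord : Fin K → (W → Option U) → List W) : Prop where
  nodup : ∀ i ψ, (ord i ψ).Nodup
  mem_iff : ∀ i ψ x, x ∈ ord i ψ ↔ S.partH x = i
  antitone : ∀ (i : Fin K) ψ, (i : ℕ) + 1 < K →
    (ord i ψ).Pairwise fun x y => S.defect (S.imageTuple y ψ) i ≤ S.defect (S.imageTuple x ψ) i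

end PartitionedPair

/-! Suppose an outcome has total defect below θ_i/2 on every W_i with i < K. Since defects are
non-increasing along the order, the vertex at position m (counted from 0) has defect below
θ_i/(2(m+1)), so its neighbourhood has more than 2(m+1) vertices or at least θ_i ≥ 2|W_i|. At most m
of them are used, so a fresh neighbour is always chosen (`two_mul_le_card_nbhd`), and edges are
assembled vertex by vertex in decreasing order of the parts (`isEmbedding_of_mem_nbhd`).

Such an outcome exists by a first moment argument, which needs a bound on the expected defect ω_x.
If ψ(f_x) were uniform in 𝒬_x, this would be a moment μ_t. Instead, the image of z is chosen with
density at most 2γ max(1, ω_z) relative to the uniform law on its part (`card_V_le`). Dividing by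
these factors gives a supermartingale (`lexpect_stepPMF_potential_le`), hence E[ω_x^{4d} ∏_y max(1,
ω_y)⁻¹] ≤ (2γ)^d μ_{4d}, with y running over the coordinates of f_x. The inequality
`ENNReal.pow_le_add_sum_pow` removes the product at the price of (2d)⁻¹ ∑_y ω_y^d. All y lie in
later parts, so an induction from the last part bounds E[ω_x^d] (`lexpect_vertexDefect_pow_le`). -/

/-! ### Expectations of [0,∞]-valued functions under discrete laws. -/

namespace PMF

variable {α β : Type*}

/-- The expectation of a nonnegative function under a discrete law. -/
noncomputable def lexpect (p : PMF α) (f : α → ℝ≥0∞) : ℝ≥0∞ := ∑' a, p a * f a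

theorem lexpect_pure (a : α) (f : α → ℝ≥0∞) : (PMF.pure a).lexpect f = f a := by
  rw [lexpect, tsum_eq_single a]
  · simp
  · intro b hb
    simp [PMF.pure_apply, hb]

theorem lexpect_bind (p : PMF α) (q : α → PMF β) (f : β → ℝ≥0∞) :
    (p.bind q).lexpect f = p.lexpect fun a => (q a).lexpect f := by
  simp only [lexpect, PMF.bind_apply, ← ENNReal.tsum_mul_right, ← ENNReal.tsum_mul_left]
  rw [ENNReal.tsum_comm]
  simp only [mul_assoc]

theorem lexpect_map (p : PMF α) (g : α → β) (f : β → ℝ≥0∞) :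
    (p.map g).lexpect f = p.lexpect fun a => f (g a) := by
  rw [← PMF.bind_pure_comp, lexpect_bind]
  simp only [Function.comp, lexpect_pure]

theorem lexpect_const (p : PMF α) (c : ℝ≥0∞) : (p.lexpect fun _ => c) = c := by
  simp [lexpect, ENNReal.tsum_mul_right, p.tsum_coe]

theorem lexpect_mono {p : PMF α} {f g : α → ℝ≥0∞} (h : ∀ a ∈ p.support, f a ≤ g a) :
    p.lexpect f ≤ p.lexpect g := by
  refine ENNReal.tsum_le_tsum fun a => ?_
  by_cases ha : a ∈ p.support
  · gcongr
    exact h a ha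
  · simp [(PMF.apply_eq_zero_iff p a).2 ha]

theorem lexpect_add (p : PMF α) (f g : α → ℝ≥0∞) :
    (p.lexpect fun a => f a + g a) = p.lexpect f + p.lexpect g := by
  simp only [lexpect, mul_add, ENNReal.tsum_add]

theorem lexpect_const_mul (p : PMF α) (c : ℝ≥0∞) (f : α → ℝ≥0∞) :
    (p.lexpect fun a => c * f a) = c * p.lexpect f := by
  simp only [lexpect, ← ENNReal.tsum_mul_left, mul_left_comm]

theorem lexpect_finset_sum {ι : Type*} (p : PMF α) (s : Finset ι) (f : ι → α → ℝ≥0∞) :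
    (p.lexpect fun a => ∑ i ∈ s, f i a) = ∑ i ∈ s, p.lexpect (f i) := by
  simp only [lexpect, Finset.mul_sum]
  exact Summable.tsum_finsetSum fun _ _ => ENNReal.summable

theorem exists_mem_support_lt {p : PMF α} {f : α → ℝ≥0∞} {c : ℝ≥0∞} (h : p.lexpect f < c) :
    ∃ a ∈ p.support, f a < c := by
  by_contra! hcon
  have := lexpect_mono (p := p) (f := fun _ => c) (g := f) hcon
  rw [lexpect_const] at this
  exact absurd h (not_lt.2 this)

theorem lexpect_uniformOfFinset (s : Finset α) (hs : s.Nonempty) (f : α → ℝ≥0∞) :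
    (PMF.uniformOfFinset s hs).lexpect f = (s.card : ℝ≥0∞)⁻¹ * ∑ a ∈ s, f a := by
  rw [lexpect, tsum_eq_sum (s := s), Finset.mul_sum]
  · refine Finset.sum_congr rfl fun a ha => ?_
    rw [PMF.uniformOfFinset_apply_of_mem hs ha]
  · intro a ha
    rw [PMF.uniformOfFinset_apply_of_notMem hs ha, zero_mul]

end PMF

/-! ### The defect function. -/

section omegaFun

theorem omegaFun_antitone {θ x y : ℝ} (hx : 0 ≤ x) (hxy : x ≤ y) :
    omegaFun θ y ≤ omegaFun θ x := by
  unfold omegaFun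
  rcases hx.eq_or_lt with rfl | hx
  · simp
  have hy : 0 < y := hx.trans_le hxy
  rw [if_neg hx.ne', if_neg hy.ne']
  split_ifs with h1 h2
  · exact ENNReal.ofReal_le_ofReal (div_le_div_of_nonneg_left (hy.trans h1).le hx hxy)
  · exact absurd (hxy.trans_lt h1) h2
  · simp
  · simp

/-- The gap between 0 and 1 makes powers of a defect increase with the exponent, even when the
defect is small. -/
theorem omegaFun_eq_zero_or_one_le {θ x : ℝ} (hx : 0 ≤ x) :
    omegaFun θ x = 0 ∨ 1 ≤ omegaFun θ x := by
  unfold omegaFun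
  split_ifs with h0 h1
  · simp
  · right
    rw [ENNReal.one_le_ofReal, one_le_div (hx.lt_of_ne' h0)]
    exact h1.le
  · simp

theorem le_max_one_omegaFun_mul {θ : ℝ} {n : ℕ} (hn : n ≠ 0) :
    ENNReal.ofReal θ ≤ max 1 (omegaFun θ n) * n := by
  have hn' : (0 : ℝ) < n := by positivity
  rcases lt_or_ge (n : ℝ) θ with h | h
  · have : omegaFun θ n = ENNReal.ofReal (θ / n) := by
      rw [omegaFun, if_neg hn'.ne', if_pos h]
    calc ENNReal.ofReal θ = ENNReal.ofReal (θ / n) * n := by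
          rw [← ENNReal.ofReal_natCast n, ← ENNReal.ofReal_mul (by have := hn'.trans h; positivity),
            div_mul_cancel₀ _ hn'.ne']
      _ ≤ _ := by rw [this]; gcongr; exact le_max_right _ _
  · calc ENNReal.ofReal θ ≤ ENNReal.ofReal n := ENNReal.ofReal_le_ofReal h
      _ = 1 * n := by simp
      _ ≤ _ := by gcongr; exact le_max_left _ _

end omegaFun

/-! ### An inequality for decoupling defects, and resampling one coordinate. -/

/-- Either some ω_i^d is at least 2d·a^d, and the sum alone suffices, or the product Z of the max(1,
ω_i) is at most 2d·a^d, and then a^d·Z ≤ 2d·a^{2d} ≤ 2d·a^{4d}. -/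
theorem ENNReal.pow_le_add_sum_pow {ι : Type*} (D : Finset ι) (ω : ι → ℝ≥0∞) {a : ℝ≥0∞} {d : ℕ}
    (hd : 1 ≤ d) (hD : D.card ≤ d) (ha : a = 0 ∨ 1 ≤ a) :
    a ^ d ≤ (2 * d : ℝ≥0∞) * (a ^ (4 * d) * ∏ i ∈ D, (max 1 (ω i))⁻¹) +
      (2 * d : ℝ≥0∞)⁻¹ * ∑ i ∈ D, ω i ^ d := by
  have hd0 : d ≠ 0 := by omega
  rcases ha with rfl | ha
  · simp [hd0]
  have hC : (1 : ℝ≥0∞) ≤ 2 * d := by exact_mod_cast (by omega : 1 ≤ 2 * d)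
  have hC0 : (2 * d : ℝ≥0∞) ≠ 0 := (zero_lt_one.trans_le hC).ne'
  have hCt : (2 * d : ℝ≥0∞) ≠ ⊤ := by finiteness
  by_cases hcase : ∃ i ∈ D, (2 * d : ℝ≥0∞) * a ^ d ≤ ω i ^ d
  · obtain ⟨i, hi, h⟩ := hcase
    refine le_add_left ?_
    rw [mul_comm, ← div_eq_mul_inv, ENNReal.le_div_iff_mul_le (.inl hC0) (.inl hCt), mul_comm]
    exact h.trans (Finset.single_le_sum (f := fun i => ω i ^ d) (fun _ _ => zero_le) hi)
  push Not at hcase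
  refine le_add_right ?_
  -- Strictness in this case excludes infinite ω_i, so the inverse of the product may be taken
  -- factor by factor.
  have hm : ∀ i ∈ D, max 1 (ω i) ≠ ⊤ := by
    intro i hi h
    have hω : ω i = ⊤ := by simpa using h
    have := hcase i hi
    rw [hω, ENNReal.top_pow hd0] at this
    exact absurd this (not_lt.2 le_top)
  set Z := ∏ i ∈ D, max 1 (ω i) with hZ
  have hZinv : ∏ i ∈ D, (max 1 (ω i))⁻¹ = Z⁻¹ := by
    rw [hZ, ENNReal.prod_inv_distrib]
    intro i hi j hj _
    exact Or.inr (hm j hj)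
  have hZt : Z ≠ ⊤ := ENNReal.prod_ne_top hm
  have hZ0 : Z ≠ 0 := Finset.prod_ne_zero_iff.2 fun i _ =>
    (zero_lt_one.trans_le (le_max_left _ _)).ne'
  have ha1 : 1 ≤ a ^ d := one_le_pow₀ ha
  have hCa : 1 ≤ (2 * d : ℝ≥0∞) * a ^ d := one_le_mul hC ha1
  have hZle : Z ≤ (2 * d : ℝ≥0∞) * a ^ d := by
    rw [← ENNReal.pow_le_pow_left_iff hd0, hZ, ← Finset.prod_pow]
    calc ∏ i ∈ D, max 1 (ω i) ^ d ≤ ∏ i ∈ D, ((2 * d : ℝ≥0∞) * a ^ d) := by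
          refine Finset.prod_le_prod' fun i hi => ?_
          rcases max_cases 1 (ω i) with ⟨h, _⟩ | ⟨h, _⟩
          · rw [h, one_pow]; exact hCa
          · rw [h]; exact (hcase i hi).le
      _ = ((2 * d : ℝ≥0∞) * a ^ d) ^ D.card := by rw [Finset.prod_const]
      _ ≤ _ := pow_le_pow_right₀ hCa hD
  rw [hZinv, ← mul_assoc, ← div_eq_mul_inv, ENNReal.le_div_iff_mul_le (.inl hZ0) (.inl hZt)]
  calc a ^ d * Z ≤ a ^ d * ((2 * d : ℝ≥0∞) * a ^ d) := by gcongr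
    _ = (2 * d : ℝ≥0∞) * a ^ (2 * d) := by ring
    _ ≤ (2 * d : ℝ≥0∞) * a ^ (4 * d) :=
        mul_le_mul' le_rfl (pow_le_pow_right₀ ha (by omega))

/-- Exchanging v with the j-th coordinate of q is an involution on the pairs (q, v). -/
theorem Fintype.sum_piFinset_sum_update {ι α M : Type*} [Fintype ι] [DecidableEq ι]
    [AddCommMonoid M] (V : ι → Finset α) (B : (ι → α) → M) (j : ι) :
    ∑ q ∈ Fintype.piFinset V, ∑ v ∈ V j, B (Function.update q j v) =
      (V j).card • ∑ q ∈ Fintype.piFinset V, B q := by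
  rw [← Finset.sum_product', ← Finset.sum_const, ← Finset.sum_product_right' (Fintype.piFinset V)
    (V j) (fun q _ => B q)]
  refine Finset.sum_nbij' (fun p => (Function.update p.1 j p.2, p.1 j))
    (fun p => (Function.update p.1 j p.2, p.1 j)) ?_ ?_ ?_ ?_ ?_
  · rintro ⟨q, v⟩ h
    simp only [Finset.mem_product, Fintype.mem_piFinset] at h ⊢
    refine ⟨fun i => ?_, h.1 j⟩
    by_cases hi : i = j
    · subst hi; simpa using h.2
    · simpa [hi] using h.1 i
  · rintro ⟨q, v⟩ h
    simp only [Finset.mem_product, Fintype.mem_piFinset] at h ⊢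
    refine ⟨fun i => ?_, h.1 j⟩
    by_cases hi : i = j
    · subst hi; simpa using h.2
    · simpa [hi] using h.1 i
  · rintro ⟨q, v⟩ h
    simp
  · rintro ⟨q, v⟩ h
    simp
  · rintro ⟨q, v⟩ h
    simp

/-! ### Sizes of the choice sets. -/

namespace PartitionedPair

variable {U W : Type*} [Fintype U] [Fintype W] {k K d : ℕ} (S : PartitionedPair U W k K d)

theorem mem_V {i : Fin K} {u : U} : u ∈ S.V i ↔ S.partG u = i := by simp [V]

theorem mem_Wpart {i : Fin K} {x : W} : x ∈ S.Wpart i ↔ S.partH x = i := by simp [Wpart]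

theorem mem_nonLast {i : Fin K} : i ∈ S.nonLast ↔ (i : ℕ) + 1 < K := by simp [nonLast]

theorem nbhd_subset_V (Q : Set U) (i : Fin K) : S.nbhd Q i ⊆ S.V i := by
  classical exact Finset.filter_subset _ _

theorem nbhd_anti {Q Q' : Set U} (h : Q ⊆ Q') (i : Fin K) : S.nbhd Q' i ⊆ S.nbhd Q i := by
  classical
  intro v hv
  simp only [nbhd, Finset.mem_filter] at hv ⊢
  exact ⟨hv.1, hv.2.1, fun e he => hv.2.2 e ⟨he.1.trans h, he.2⟩⟩

theorem defect_mono {Q Q' : Set U} (h : Q ⊆ Q') (i : Fin K) : S.defect Q i ≤ S.defect Q' i :=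
  omegaFun_antitone (by positivity) (by exact_mod_cast Finset.card_le_card (S.nbhd_anti h i))

theorem defect_eq_zero_or_one_le (Q : Set U) (i : Fin K) : S.defect Q i = 0 ∨ 1 ≤ S.defect Q i :=
  omegaFun_eq_zero_or_one_le (by positivity)

/-- The defect of the vertex `x` in the state `ψ`, which is `0` in the last part. -/
noncomputable def vertexDefect (x : W) (ψ : W → Option U) : ℝ≥0∞ :=
  if (S.partH x : ℕ) + 1 < K then S.defect (S.imageTuple x ψ) (S.partH x) else 0

theorem card_used_le (i : Fin K) (ψ : W → Option U) (l : Finset W)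
    (h : ∀ y, S.partH y = i → ψ y ≠ none → y ∈ l) : (S.used i ψ).card ≤ l.card := by
  classical
  have hsub : (S.used i ψ).map ⟨some, Option.some_injective U⟩ ⊆ l.image ψ := by
    intro o ho
    simp only [used, Finset.mem_map, Finset.mem_filter, Finset.mem_univ, true_and,
      Function.Embedding.coeFn_mk] at ho
    obtain ⟨u, ⟨y, hy, hyu⟩, rfl⟩ := ho
    exact Finset.mem_image.2 ⟨y, h y hy (by simp [hyu]), hyu⟩
  calc (S.used i ψ).card = _ := (Finset.card_map _).symm
    _ ≤ _ := Finset.card_le_card hsub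
    _ ≤ _ := Finset.card_image_le

theorem choices_subset_V (x : W) (ψ : W → Option U) : S.choices x ψ ⊆ S.V (S.partH x) := by
  classical
  have := S.nbhd_subset_V (S.imageTuple x ψ) (S.partH x)
  unfold choices
  dsimp only
  split_ifs
  · exact subset_rfl
  · exact this
  · exact Finset.sdiff_subset.trans this
  · exact Finset.sdiff_subset

/-- The choice sets are large in terms of the defect. -/
theorem card_V_le (hlast : ∀ i : Fin K, (i : ℕ) + 1 = K → 2 * (S.Wpart i).card ≤ (S.V i).card)
    (x : W) (ψ : W → Option U) :
    ((S.V (S.partH x)).card : ℝ≥0∞) ≤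
      2 * S.gamma * max 1 (S.vertexDefect x ψ) * (S.choices x ψ).card := by
  classical
  have hγ : 1 ≤ S.gamma := le_max_left _ _
  have hbase : ∀ a b : ℕ, a ≤ 2 * b →
      (a : ℝ≥0∞) ≤ 2 * S.gamma * max 1 (S.vertexDefect x ψ) * b := by
    intro a b hab
    calc (a : ℝ≥0∞) ≤ 2 * 1 * 1 * b := by rw [mul_one, mul_one]; exact_mod_cast hab
      _ ≤ _ := by gcongr; exact le_max_left _ _
  by_cases hi : (S.partH x : ℕ) + 1 < K
  · by_cases hN : (S.nbhd (S.imageTuple x ψ) (S.partH x)).card = 0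
    · have : S.choices x ψ = S.V (S.partH x) := by simp [choices, hi, hN]
      rw [this]
      exact hbase _ _ (by omega)
    -- The algorithm falls back to N when L is small, so at least half of |N| is always available,
    -- even in bad states.
    · have hc : (S.nbhd (S.imageTuple x ψ) (S.partH x)).card ≤ 2 * (S.choices x ψ).card := by
        simp only [choices, if_pos hi, if_neg hN]
        split_ifs with h
        · omega
        · omega
      have hθ : ENNReal.ofReal (S.θ (S.partH x)) ≠ 0 := by
        simpa using S.θ_pos _ hi
      have h1 : ((S.V (S.partH x)).card : ℝ≥0∞) ≤
          S.gamma * ENNReal.ofReal (S.θ (S.partH x)) := by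
        rw [← ENNReal.div_le_iff_le_mul (.inl hθ) (.inl ENNReal.ofReal_ne_top)]
        exact le_max_of_le_right (Finset.le_sup
          (f := fun i => ((S.V i).card : ℝ≥0∞) / ENNReal.ofReal (S.θ i)) (S.mem_nonLast.2 hi))
      have h2 := le_max_one_omegaFun_mul (θ := S.θ (S.partH x)) hN
      have h3 : S.vertexDefect x ψ = omegaFun (S.θ (S.partH x))
        (S.nbhd (S.imageTuple x ψ) (S.partH x)).card := by simp [vertexDefect, hi, defect]
      rw [← h3] at h2
      have hc' : ((S.nbhd (S.imageTuple x ψ) (S.partH x)).card : ℝ≥0∞) ≤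
        2 * (S.choices x ψ).card := by exact_mod_cast hc
      calc _ ≤ _ := h1
        _ ≤ S.gamma * (max 1 (S.vertexDefect x ψ) * (2 * (S.choices x ψ).card)) := by
          gcongr; exact h2.trans (by gcongr)
        _ = _ := by ring
  · have hc : S.choices x ψ = S.V (S.partH x) \ S.used (S.partH x) ψ := by simp [choices, hi]
    have h1 := S.card_used_le (S.partH x) ψ (S.Wpart (S.partH x))
      (fun y hy _ => S.mem_Wpart.2 hy)
    have h2 := hlast (S.partH x) (by have := (S.partH x).isLt; omega)
    have h3 := Finset.le_card_sdiff (S.used (S.partH x) ψ) (S.V (S.partH x))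
    rw [← hc] at h3
    exact hbase _ _ (by omega)

theorem choices_nonempty
    (hlast : ∀ i : Fin K, (i : ℕ) + 1 = K → 2 * (S.Wpart i).card ≤ (S.V i).card)
    (hV : ∀ x, (S.V (S.partH x)).Nonempty) (x : W) (ψ : W → Option U) :
    (S.choices x ψ).Nonempty := by
  by_contra h
  rw [Finset.not_nonempty_iff_eq_empty] at h
  have := S.card_V_le hlast x ψ
  rw [h] at this
  simp only [Finset.card_empty, Nat.cast_zero, mul_zero, nonpos_iff_eq_zero, Nat.cast_eq_zero,
    Finset.card_eq_zero] at this
  exact (hV x).ne_empty this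

/-! ### From single steps to the whole process. -/

theorem lexpect_stepPMF [DecidableEq W] {x : W} {ψ : W → Option U} (h : (S.choices x ψ).Nonempty)
    (Φ : (W → Option U) → ℝ≥0∞) :
    (S.stepPMF x ψ).lexpect Φ = ((S.choices x ψ).card : ℝ≥0∞)⁻¹ *
      ∑ u ∈ S.choices x ψ, Φ (Function.update ψ x (some u)) := by
  rw [stepPMF, dif_pos h, PMF.lexpect_map, PMF.lexpect_uniformOfFinset]
  congr!

theorem exists_of_mem_support_stepPMF [DecidableEq W] {x : W} {ψ ψ' : W → Option U}
    (h : (S.choices x ψ).Nonempty) (hψ' : ψ' ∈ (S.stepPMF x ψ).support) :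
    ∃ u ∈ S.choices x ψ, ψ' = Function.update ψ x (some u) := by
  rw [stepPMF, dif_pos h, PMF.support_map, PMF.support_uniformOfFinset] at hψ'
  obtain ⟨u, hu, rfl⟩ := hψ'
  exact ⟨u, hu, by congr!⟩

/-- The random greedy process may embed `x` next in the state `ψ`. -/
structure Ready (x : W) (ψ : W → Option U) : Prop where
  unset : ψ x = none
  later : ∀ y, S.partH x < S.partH y → ψ y ≠ none
  earlier : ∀ y, S.partH y < S.partH x → ψ y = none

theorem imageTuple_congr {x : W} {ψ ψ' : W → Option U} (h : ∀ j, ψ' (S.f x j) = ψ (S.f x j)) :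
    S.imageTuple x ψ' = S.imageTuple x ψ := by
  simp only [imageTuple, h]

/-- The coordinates of f_x lie in later parts, so the defect of x is settled before its own part is
treated. -/
theorem vertexDefect_congr {x : W} {ψ ψ' : W → Option U}
    (h : ∀ y, S.partH x < S.partH y → ψ' y = ψ y) :
    S.vertexDefect x ψ' = S.vertexDefect x ψ := by
  unfold vertexDefect
  split_ifs with hx
  · rw [S.imageTuple_congr fun j => h _ (S.f_later x hx j)]
  · rfl

theorem mem_support_listPMF (hne : ∀ x ψ, (S.choices x ψ).Nonempty) (l : List W)
    {ψ ψ' : W → Option U} (h : ψ' ∈ (S.listPMF l ψ).support) :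
    (∀ y, y ∉ l → ψ' y = ψ y) ∧ ∀ y ∈ l, ψ' y ≠ none := by
  classical
  induction l generalizing ψ with
  | nil =>
    simp only [listPMF, PMF.support_pure, Set.mem_singleton_iff] at h
    simp [h]
  | cons x l ih =>
    rw [listPMF, PMF.mem_support_bind_iff] at h
    obtain ⟨ψ₁, h1, h2⟩ := h
    obtain ⟨u, -, rfl⟩ := S.exists_of_mem_support_stepPMF (hne x ψ) h1
    obtain ⟨h3, h4⟩ := ih h2
    refine ⟨fun y hy => ?_, fun y hy => ?_⟩
    · simp only [List.mem_cons, not_or] at hy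
      rw [h3 y hy.2, Function.update_of_ne hy.1]
    · by_cases hyl : y ∈ l
      · exact h4 y hyl
      · obtain rfl : y = x := by simpa [hyl] using hy
        rw [h3 y hyl]
        simp

/-- The supermartingale inequality is needed only in the states that satisfy `Ready`; these
invariants are carried through the list. -/
theorem lexpect_listPMF_le (hne : ∀ x ψ, (S.choices x ψ).Nonempty) {Φ : (W → Option U) → ℝ≥0∞}
    (hΦ : ∀ x ψ, S.Ready x ψ → (S.stepPMF x ψ).lexpect Φ ≤ Φ ψ) (i : Fin K) (l : List W)
    {ψ : W → Option U} (hnd : l.Nodup) (hl : ∀ x ∈ l, S.partH x = i ∧ ψ x = none)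
    (hlater : ∀ y, i < S.partH y → ψ y ≠ none) (hearlier : ∀ y, S.partH y < i → ψ y = none) :
    (S.listPMF l ψ).lexpect Φ ≤ Φ ψ := by
  classical
  induction l generalizing ψ with
  | nil => rw [listPMF, PMF.lexpect_pure]
  | cons x l ih =>
    rw [listPMF, PMF.lexpect_bind]
    have hx := hl x (by simp)
    rw [List.nodup_cons] at hnd
    refine (PMF.lexpect_mono fun ψ₁ h1 => ?_).trans (hΦ x ψ ⟨hx.2, ?_, ?_⟩)
    · obtain ⟨u, -, rfl⟩ := S.exists_of_mem_support_stepPMF (hne x ψ) h1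
      refine ih hnd.2 (fun y hy => ?_) (fun y hy => ?_) (fun y hy => ?_)
      · rw [Function.update_of_ne (by rintro rfl; exact hnd.1 hy)]
        exact hl y (by simp [hy])
      · rw [Function.update_of_ne (by rintro rfl; exact absurd hx.1 hy.ne')]
        exact hlater y hy
      · rw [Function.update_of_ne (by rintro rfl; exact absurd hx.1 hy.ne)]
        exact hearlier y hy
    · rw [hx.1]; exact hlater
    · rw [hx.1]; exact hearlier

/-- The indices in the list `l` are those of the parts that are still to be embedded in the
state `ψ`, in decreasing order. -/
structure Pending (l : List (Fin K)) (ψ : W → Option U) : Prop where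
  sorted : l.Pairwise (· > ·)
  closed : ∀ i ∈ l, ∀ j < i, j ∈ l
  eq_none_iff : ∀ y, ψ y = none ↔ S.partH y ∈ l

variable {S}

theorem Pending.earlier {i : Fin K} {l : List (Fin K)} {ψ : W → Option U}
    (h : S.Pending (i :: l) ψ) {y : W} (hy : S.partH y < i) : ψ y = none :=
  (h.eq_none_iff y).2 (h.closed i (by simp) _ hy)

theorem Pending.later {i : Fin K} {l : List (Fin K)} {ψ : W → Option U}
    (h : S.Pending (i :: l) ψ) {y : W} (hy : i < S.partH y) : ψ y ≠ none := by
  rw [Ne, h.eq_none_iff y, List.mem_cons, not_or]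
  exact ⟨hy.ne', fun hm => absurd ((List.pairwise_cons.1 h.sorted).1 _ hm) (not_lt.2 hy.le)⟩

theorem Pending.tail (hne : ∀ x ψ, (S.choices x ψ).Nonempty) {i : Fin K} {l : List (Fin K)}
    {ψ ψ' : W → Option U} (h : S.Pending (i :: l) ψ) {o : List W}
    (ho : ∀ x, x ∈ o ↔ S.partH x = i) (hψ' : ψ' ∈ (S.listPMF o ψ).support) :
    S.Pending l ψ' := by
  obtain ⟨h1, h2⟩ := S.mem_support_listPMF hne o hψ'
  obtain ⟨hs1, hs2⟩ := List.pairwise_cons.1 h.sorted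
  refine ⟨hs2, fun a ha b hb => ?_, fun y => ?_⟩
  · have := h.closed a (by simp [ha]) b hb
    rcases List.mem_cons.1 this with rfl | h'
    · exact absurd (hs1 a ha) (not_lt.2 hb.le)
    · exact h'
  · by_cases hy : S.partH y = i
    · simp only [h2 y ((ho y).2 hy), false_iff]
      intro hm
      exact absurd (hs1 _ hm) (by simp [hy])
    · rw [h1 y (mt (ho y).1 hy), h.eq_none_iff y]
      simp [hy]

theorem pending_finRange : S.Pending (List.finRange K).reverse fun _ => none := by
  refine ⟨?_, fun _ _ _ _ => by simp, fun y => by simp⟩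
  rw [List.pairwise_reverse]
  exact List.pairwise_lt_finRange K

theorem lexpect_partsPMF_le (hne : ∀ x ψ, (S.choices x ψ).Nonempty) {Φ : (W → Option U) → ℝ≥0∞}
    (hΦ : ∀ x ψ, S.Ready x ψ → (S.stepPMF x ψ).lexpect Φ ≤ Φ ψ)
    {ord : Fin K → (W → Option U) → List W} (hord : S.IsOrderRule ord) (l : List (Fin K))
    {ψ : W → Option U} (h : S.Pending l ψ) : (S.partsPMF ord l ψ).lexpect Φ ≤ Φ ψ := by
  induction l generalizing ψ with
  | nil => rw [partsPMF, PMF.lexpect_pure]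
  | cons i l ih =>
    rw [partsPMF, PMF.lexpect_bind]
    refine (PMF.lexpect_mono fun ψ₁ h1 => ih (h.tail hne (hord.mem_iff i ψ) h1)).trans ?_
    refine S.lexpect_listPMF_le hne hΦ i _ (hord.nodup i ψ) (fun x hx => ?_)
      (fun y => h.later) (fun y => h.earlier)
    have := (hord.mem_iff i ψ x).1 hx
    exact ⟨this, (h.eq_none_iff x).2 (by simp [this])⟩

theorem lexpect_greedyPMF_le (hne : ∀ x ψ, (S.choices x ψ).Nonempty) {Φ : (W → Option U) → ℝ≥0∞}
    (hΦ : ∀ x ψ, S.Ready x ψ → (S.stepPMF x ψ).lexpect Φ ≤ Φ ψ)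
    {ord : Fin K → (W → Option U) → List W} (hord : S.IsOrderRule ord) :
    (S.greedyPMF ord).lexpect Φ ≤ Φ fun _ => none :=
  lexpect_partsPMF_le hne hΦ hord _ pending_finRange

end PartitionedPair

/-! ### The potential and its supermartingale property. -/

namespace PartitionedPair

variable {U W : Type*} [Fintype U] [Fintype W] {k K d : ℕ} (S : PartitionedPair U W k K d)

/-- The set `ψ(f_x)`, where the missing coordinates are taken from the tuple `q`. -/
def completedTuple (x : W) (ψ : W → Option U) (q : Fin d → U) : Set U :=
  Set.range fun j => (ψ (S.f x j)).getD (q j)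

open Classical in
/-- The weight of a vertex in the potential. -/
noncomputable def weight (y : W) (ψ : W → Option U) : ℝ≥0∞ :=
  if ψ y = none then 2 * S.gamma else (max 1 (S.vertexDefect y ψ))⁻¹

/-- The set of the coordinates of `f_x`. -/
noncomputable def coords (x : W) : Finset W := by
  classical exact Finset.univ.image (S.f x)

/-- The sum of the `t`-th powers of the defects of all completions of `ψ(f_x)`. -/
noncomputable def completionSum (t : ℕ) (x : W) (ψ : W → Option U) : ℝ≥0∞ :=
  ∑ q ∈ S.tuples x, S.defect (S.completedTuple x ψ q) (S.partH x) ^ t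

/-- A supermartingale that interpolates between the average of the `t`-th power defect of `x` and
its weighted value in the final state. -/
noncomputable def potential (t : ℕ) (x : W) (ψ : W → Option U) : ℝ≥0∞ :=
  S.completionSum t x ψ / (S.tuples x).card * ∏ y ∈ S.coords x, S.weight y ψ

theorem mem_coords {x y : W} : y ∈ S.coords x ↔ ∃ j, S.f x j = y := by
  classical
  simp [coords]

theorem card_coords_le (x : W) : (S.coords x).card ≤ d := by
  classical
  unfold coords
  exact Finset.card_image_le.trans (by simp)

theorem weight_update [DecidableEq W] {z y : W} {ψ : W → Option U} (h : S.Ready z ψ) (hy : y ≠ z)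
    (u : U) : S.weight y (Function.update ψ z (some u)) = S.weight y ψ := by
  unfold weight
  rw [Function.update_of_ne hy]
  split_ifs with hn
  · rfl
  · have hle : S.partH z ≤ S.partH y := not_lt.1 fun hlt => hn (h.earlier y hlt)
    rw [S.vertexDefect_congr (ψ := ψ)]
    rintro y' hy'
    exact Function.update_of_ne (by rintro rfl; exact absurd hy' (not_lt.2 hle)) _ _

theorem weight_update_self [DecidableEq W] (z : W) (ψ : W → Option U) (u : U) :
    S.weight z (Function.update ψ z (some u)) = (max 1 (S.vertexDefect z ψ))⁻¹ := by
  unfold weight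
  rw [Function.update_self, if_neg (by simp), S.vertexDefect_congr (ψ := ψ)]
  rintro y' hy'
  exact Function.update_of_ne (by rintro rfl; exact absurd hy' (lt_irrefl _)) _ _

theorem completionSum_update_of_notMem [DecidableEq W] {t : ℕ} {x z : W} (hz : z ∉ S.coords x)
    (ψ : W → Option U) (u : U) :
    S.completionSum t x (Function.update ψ z (some u)) = S.completionSum t x ψ := by
  have (q : Fin d → U) : S.completedTuple x (Function.update ψ z (some u)) q =
      S.completedTuple x ψ q := by
    unfold completedTuple
    congr 1
    funext j
    rw [Function.update_of_ne (by rintro rfl; exact hz (S.mem_coords.2 ⟨j, rfl⟩))]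
  simp only [completionSum, this]

/-- Averaging over the image of z amounts to resampling one coordinate of q. It is only an
inequality because z may occur several times in f_x: one occurrence j is resampled, the others keep
superfluous entries of q, and these can only enlarge the set and hence its defect. -/
theorem sum_completionSum_update_le [DecidableEq W] {t : ℕ} {x z : W} (hz : z ∈ S.coords x)
    {ψ : W → Option U} (hψ : ψ z = none) :
    ∑ u ∈ S.V (S.partH z), S.completionSum t x (Function.update ψ z (some u)) ≤
      (S.V (S.partH z)).card * S.completionSum t x ψ := by
  obtain ⟨j, rfl⟩ := S.mem_coords.1 hz
  have hsub (q : Fin d → U) (u : U) :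
      S.completedTuple x (Function.update ψ (S.f x j) (some u)) q ⊆
        S.completedTuple x ψ (Function.update q j u) := by
    rintro _ ⟨i, rfl⟩
    by_cases hi : S.f x i = S.f x j
    · exact ⟨j, by simp [hi, hψ]⟩
    · have hij : i ≠ j := fun h => hi (h ▸ rfl)
      exact ⟨i, by simp [hi, hij]⟩
  have key := Fintype.sum_piFinset_sum_update (fun j => S.V (S.partH (S.f x j)))
    (fun q => S.defect (S.completedTuple x ψ q) (S.partH x) ^ t) j
  calc _ ≤ ∑ u ∈ S.V (S.partH (S.f x j)), ∑ q ∈ S.tuples x,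
        S.defect (S.completedTuple x ψ (Function.update q j u)) (S.partH x) ^ t := by
        refine Finset.sum_le_sum fun u _ => Finset.sum_le_sum fun q _ => ?_
        gcongr
        exact S.defect_mono (hsub q u) _
    _ = ∑ q ∈ S.tuples x, ∑ u ∈ S.V (S.partH (S.f x j)),
        S.defect (S.completedTuple x ψ (Function.update q j u)) (S.partH x) ^ t :=
        Finset.sum_comm
    _ = _ := by
        unfold completionSum tuples
        rw [key, nsmul_eq_mul]

/-- Passing from a uniform choice in `choices` to one in the whole part costs at most 2γ max(1,
ω_z), which is exactly the drop of the weight of z from 2γ to max(1, ω_z)⁻¹. The other weights stay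
fixed, since the defect of an embedded vertex involves only parts after its own. -/
theorem lexpect_stepPMF_potential_le
    (hlast : ∀ i : Fin K, (i : ℕ) + 1 = K → 2 * (S.Wpart i).card ≤ (S.V i).card)
    (hne : ∀ x ψ, (S.choices x ψ).Nonempty) (t : ℕ) (x : W) {z : W} {ψ : W → Option U}
    (h : S.Ready z ψ) : (S.stepPMF z ψ).lexpect (S.potential t x) ≤ S.potential t x ψ := by
  classical
  rw [S.lexpect_stepPMF (hne z ψ)]
  have hc0 : ((S.choices z ψ).card : ℝ≥0∞) ≠ 0 := by
    simpa using (hne z ψ).ne_empty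
  by_cases hz : z ∈ S.coords x
  · set R := ∏ y ∈ (S.coords x).erase z, S.weight y ψ with hR
    set m := max 1 (S.vertexDefect z ψ)
    have hpot : S.potential t x ψ =
        S.completionSum t x ψ / (S.tuples x).card * (2 * S.gamma * R) := by
      rw [potential, ← Finset.mul_prod_erase _ _ hz, ← hR]
      simp only [weight, h.unset, if_true]
    have hpotu : ∀ u, S.potential t x (Function.update ψ z (some u)) =
        S.completionSum t x (Function.update ψ z (some u)) *
          ((S.tuples x).card : ℝ≥0∞)⁻¹ * (m⁻¹ * R) := by
      intro u
      rw [potential, ← Finset.mul_prod_erase _ _ hz, S.weight_update_self, div_eq_mul_inv, hR]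
      congr 2
      exact Finset.prod_congr rfl fun y hy => S.weight_update h (Finset.ne_of_mem_erase hy) u
    have hsum : ∑ u ∈ S.choices z ψ, S.completionSum t x (Function.update ψ z (some u)) ≤
        (S.V (S.partH z)).card * S.completionSum t x ψ :=
      (Finset.sum_le_sum_of_subset (S.choices_subset_V z ψ)).trans
        (S.sum_completionSum_update_le hz h.unset)
    have hfac : ((S.V (S.partH z)).card : ℝ≥0∞) / (S.choices z ψ).card / m ≤ 2 * S.gamma :=
      ENNReal.div_le_of_le_mul (ENNReal.div_le_of_le_mul (S.card_V_le hlast z ψ))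
    simp only [hpotu, hpot, ← Finset.sum_mul]
    calc _ ≤ ((S.choices z ψ).card : ℝ≥0∞)⁻¹ *
          (((S.V (S.partH z)).card * S.completionSum t x ψ) * ((S.tuples x).card : ℝ≥0∞)⁻¹ *
            (m⁻¹ * R)) := by gcongr
      _ = S.completionSum t x ψ / (S.tuples x).card *
          (((S.V (S.partH z)).card : ℝ≥0∞) / (S.choices z ψ).card / m * R) := by
          simp only [div_eq_mul_inv]; ring
      _ ≤ _ := by gcongr
  · have : ∀ u, S.potential t x (Function.update ψ z (some u)) = S.potential t x ψ := by
      intro u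
      rw [potential, potential, S.completionSum_update_of_notMem hz]
      congr 1
      exact Finset.prod_congr rfl fun y hy => S.weight_update h (by rintro rfl; exact hz hy) u
    simp only [this, Finset.sum_const, nsmul_eq_mul]
    rw [← mul_assoc, ENNReal.inv_mul_cancel hc0 (by finiteness), one_mul]

theorem one_le_two_mul_gamma : 1 ≤ 2 * S.gamma :=
  one_le_mul (by norm_num) (le_max_left _ _)

theorem potential_none_le (t : ℕ) {x : W} (hx : (S.partH x : ℕ) + 1 < K) :
    S.potential t x (fun _ => none) ≤ (2 * S.gamma) ^ d * S.mu t := by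
  have h1 : S.completionSum t x (fun _ => none) / (S.tuples x).card = S.muAt t x := by
    simp [completionSum, completedTuple, muAt, avgDefect, hx]
  have h2 : S.muAt t x ≤ S.mu t := Finset.le_sup (f := fun x => S.muAt t x) (Finset.mem_univ x)
  rw [potential, h1, mul_comm]
  simp only [weight, if_true, Finset.prod_const]
  gcongr
  · exact S.one_le_two_mul_gamma
  · exact S.card_coords_le x

theorem potential_of_total (hV : ∀ x, (S.V (S.partH x)).Nonempty) (t : ℕ) {x : W}
    (hx : (S.partH x : ℕ) + 1 < K) {ψ : W → Option U} (hψ : ∀ y, ψ y ≠ none) :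
    S.potential t x ψ =
      S.vertexDefect x ψ ^ t * ∏ y ∈ S.coords x, (max 1 (S.vertexDefect y ψ))⁻¹ := by
  have hN : ((S.tuples x).card : ℝ≥0∞) ≠ 0 := by
    have : (S.tuples x).Nonempty := Fintype.piFinset_nonempty.2 fun j => hV _
    simpa using this.ne_empty
  have hT (q : Fin d → U) : S.completedTuple x ψ q = S.imageTuple x ψ := by
    ext u
    simp only [completedTuple, imageTuple, Set.mem_range, Set.mem_ofPred_eq]
    refine exists_congr fun j => ?_
    obtain ⟨v, hv⟩ := Option.ne_none_iff_exists'.1 (hψ (S.f x j))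
    simp [hv]
  simp only [potential, completionSum, hT, Finset.sum_const, nsmul_eq_mul, weight, hψ, if_false]
  congr 1
  rw [mul_comm, mul_div_assoc, ENNReal.div_self hN (by finiteness), mul_one, vertexDefect,
    if_pos hx]

theorem vertexDefect_eq_zero_or_one_le (x : W) (ψ : W → Option U) :
    S.vertexDefect x ψ = 0 ∨ 1 ≤ S.vertexDefect x ψ := by
  unfold vertexDefect
  split_ifs
  · exact S.defect_eq_zero_or_one_le _ _
  · exact Or.inl rfl

/-! ### Moments of the defects in the final state. -/

variable {S}

theorem mem_support_partsPMF (hne : ∀ x ψ, (S.choices x ψ).Nonempty)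
    {ord : Fin K → (W → Option U) → List W} (hord : S.IsOrderRule ord) (l : List (Fin K))
    {ψ ψ' : W → Option U} (h : S.Pending l ψ) (hψ' : ψ' ∈ (S.partsPMF ord l ψ).support) :
    (∀ y, ψ' y ≠ none) ∧ ∀ y, S.partH y ∉ l → ψ' y = ψ y := by
  induction l generalizing ψ with
  | nil =>
    simp only [partsPMF, PMF.support_pure, Set.mem_singleton_iff] at hψ'
    subst hψ'
    exact ⟨fun y => by rw [Ne, h.eq_none_iff y]; simp, fun _ _ => rfl⟩
  | cons i l ih =>
    rw [partsPMF, PMF.mem_support_bind_iff] at hψ'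
    obtain ⟨ψ₁, h1, h2⟩ := hψ'
    obtain ⟨h3, h4⟩ := ih (h.tail hne (hord.mem_iff i ψ) h1) h2
    refine ⟨h3, fun y hy => ?_⟩
    rw [List.mem_cons, not_or] at hy
    rw [h4 y hy.2, (S.mem_support_listPMF hne _ h1).1 y (mt (hord.mem_iff i ψ y).1 hy.1)]

theorem ne_none_of_mem_support_greedyPMF (hne : ∀ x ψ, (S.choices x ψ).Nonempty)
    {ord : Fin K → (W → Option U) → List W} (hord : S.IsOrderRule ord) {ψ : W → Option U}
    (hψ : ψ ∈ (S.greedyPMF ord).support) (y : W) : ψ y ≠ none :=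
  (mem_support_partsPMF hne hord _ pending_finRange hψ).1 y

theorem lexpect_vertexDefect_pow_le
    (hlast : ∀ i : Fin K, (i : ℕ) + 1 = K → 2 * (S.Wpart i).card ≤ (S.V i).card)
    (hV : ∀ x, (S.V (S.partH x)).Nonempty)
    {ord : Fin K → (W → Option U) → List W} (hord : S.IsOrderRule ord) (x : W) :
    ((S.greedyPMF ord).lexpect fun ψ => S.vertexDefect x ψ ^ d) ≤
      2 * (2 * d * ((2 * S.gamma) ^ d * S.mu (4 * d))) := by
  have hne := S.choices_nonempty hlast hV
  have hd := S.one_le_d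
  set B : ℝ≥0∞ := 2 * d * ((2 * S.gamma) ^ d * S.mu (4 * d)) with hB
  -- Induction from the last part, where the defect is 0, down to the first.
  induction x using (InvImage.wf S.partH (wellFounded_gt (α := Fin K))).induction with
  | _ x ih =>
  by_cases hx : (S.partH x : ℕ) + 1 < K
  swap
  · have : ∀ ψ, S.vertexDefect x ψ = 0 := fun ψ => by simp [vertexDefect, hx]
    simp [this, show d ≠ 0 by omega, PMF.lexpect_const]
  calc _ ≤ (S.greedyPMF ord).lexpect fun ψ => (2 * d : ℝ≥0∞) * S.potential (4 * d) x ψ +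
        (2 * d : ℝ≥0∞)⁻¹ * ∑ y ∈ S.coords x, S.vertexDefect y ψ ^ d := by
        refine PMF.lexpect_mono fun ψ hψ => ?_
        rw [S.potential_of_total hV _ hx (ne_none_of_mem_support_greedyPMF hne hord hψ)]
        exact ENNReal.pow_le_add_sum_pow _ (fun y => S.vertexDefect y ψ) hd (S.card_coords_le x)
          (S.vertexDefect_eq_zero_or_one_le x ψ)
    _ = 2 * d * (S.greedyPMF ord).lexpect (S.potential (4 * d) x) +
        (2 * d : ℝ≥0∞)⁻¹ * ∑ y ∈ S.coords x,
          (S.greedyPMF ord).lexpect fun ψ => S.vertexDefect y ψ ^ d := by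
        rw [PMF.lexpect_add, PMF.lexpect_const_mul, PMF.lexpect_const_mul,
          PMF.lexpect_finset_sum]
    -- At most d coordinates contribute 2B/(2d) each, hence at most B together. So the bound 2B
    -- reproduces itself and does not grow with the number of parts.
    _ ≤ B + (2 * d : ℝ≥0∞)⁻¹ * ∑ y ∈ S.coords x, 2 * B := by
        gcongr with y hy
        · rw [hB]
          gcongr
          exact (lexpect_greedyPMF_le hne
            (fun z ψ h => S.lexpect_stepPMF_potential_le hlast hne _ x h) hord).trans
              (S.potential_none_le _ hx)
        · obtain ⟨j, rfl⟩ := S.mem_coords.1 hy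
          exact ih _ (S.f_later x hx j)
    _ ≤ B + B := by
        gcongr
        rw [Finset.sum_const, nsmul_eq_mul]
        have hd0 : (2 * d : ℝ≥0∞) ≠ 0 := by
          have : d ≠ 0 := by omega
          simp [this]
        calc _ ≤ (2 * d : ℝ≥0∞)⁻¹ * (d * (2 * B)) := by
              gcongr
              exact S.card_coords_le x
          _ = (2 * d : ℝ≥0∞)⁻¹ * (2 * d) * B := by ring
          _ = B := by rw [ENNReal.inv_mul_cancel hd0 (by finiteness), one_mul]
    _ = 2 * B := (two_mul B).symm

theorem two_mul_le_two_pow {n : ℕ} (hn : 1 ≤ n) : 2 * n ≤ 2 ^ n := by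
  induction n, hn using Nat.le_induction with
  | base => norm_num
  | succ n hn ih => rw [pow_succ]; omega

theorem lexpect_vertexDefect_le
    (hlast : ∀ i : Fin K, (i : ℕ) + 1 = K → 2 * (S.Wpart i).card ≤ (S.V i).card)
    (hV : ∀ x, (S.V (S.partH x)).Nonempty)
    {ord : Fin K → (W → Option U) → List W} (hord : S.IsOrderRule ord) (x : W) :
    2 * (S.greedyPMF ord).lexpect (S.vertexDefect x) ≤
      2 ^ (2 * d + 2) * S.gamma ^ (2 * d) * S.mu (4 * d) := by
  have hd := S.one_le_d
  have h2d : (2 * d : ℝ≥0∞) ≤ 2 ^ d := by exact_mod_cast two_mul_le_two_pow hd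
  have hγ : 1 ≤ S.gamma := le_max_left _ _
  calc 2 * (S.greedyPMF ord).lexpect (S.vertexDefect x)
      ≤ 2 * (S.greedyPMF ord).lexpect fun ψ => S.vertexDefect x ψ ^ d := by
        gcongr
        refine PMF.lexpect_mono fun ψ _ => ?_
        rcases S.vertexDefect_eq_zero_or_one_le x ψ with h | h
        · simp [h]
        · exact le_self_pow₀ h (by omega)
    _ ≤ 2 * (2 * (2 * d * ((2 * S.gamma) ^ d * S.mu (4 * d)))) := by
        gcongr
        exact lexpect_vertexDefect_pow_le hlast hV hord x
    -- The factor 2d is absorbed by 2^d; with (2γ)^d and the two factors 2 this makes the constant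
    -- 2^{2d+2}.
    _ ≤ 2 * (2 * (2 ^ d * ((2 * S.gamma) ^ d * S.mu (4 * d)))) := by gcongr
    _ = 2 ^ (2 * d + 2) * S.gamma ^ d * S.mu (4 * d) := by rw [mul_pow]; ring
    _ ≤ _ := by
        gcongr
        omega

end PartitionedPair

/-! ### From neighbourhoods to edges, and nonemptiness of the parts that are needed. -/

/-- A partial edge with the full number of vertices is an edge. -/
theorem Hypergraph.IsUniform.mem_edgeSet_of_mem_partialEdges {U : Type*} {G : Hypergraph U} {k : ℕ}
    (hG : G.IsUniform k) (hk : k ≠ 0) {s : Set U} (hs : s ∈ G.partialEdges) (hsk : s.ncard = k) :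
    s ∈ G.edgeSet := by
  obtain ⟨f, hf, hsf⟩ := hs
  have hfk := hG f hf
  have hfin : f.Finite := Set.finite_of_ncard_ne_zero (by omega)
  rwa [Set.eq_of_subset_of_ncard_le hsf (by omega) hfin]

namespace PartitionedPair

variable {U W : Type*} [Fintype U] [Fintype W] {k K d : ℕ} (S : PartitionedPair U W k K d)

/-- Grow a subset of an edge of H by adding vertices x of smaller and smaller part index. The
vertices already present lie in N^+(x), so their image is a partial edge inside φ(f_x), and φ(x)
extends it. The first vertex needs the absence of isolated vertices in G. -/
theorem isEmbedding_of_mem_nbhd {φ : W → U} (hinj : Function.Injective φ)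
    (hφ : ∀ x, (S.partH x : ℕ) + 1 < K →
      φ x ∈ S.nbhd (S.imageTuple x fun y => some (φ y)) (S.partH x)) :
    S.H.IsEmbedding S.G φ := by
  classical
  refine ⟨hinj, fun e he => ?_⟩
  have hk := S.two_le_k
  have hek := S.uniform_H e he
  have hne : e.Nonempty := Set.nonempty_of_ncard_ne_zero (by omega)
  have hedge : ∃ g, g ∈ S.G.edgeSet := by
    obtain ⟨x, hx⟩ := hne
    have := S.no_isolated (φ x)
    simp only [Hypergraph.IsIsolated, not_forall] at this
    obtain ⟨g, hg, -⟩ := this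
    exact ⟨g, hg⟩
  have key : ∀ s : Finset W, (s : Set W) ⊆ e → φ '' s ∈ S.G.partialEdges := by
    intro s
    induction s using Finset.induction_on_min_value S.partH with
    | empty =>
      obtain ⟨g, hg⟩ := hedge
      exact fun _ => ⟨g, hg, by simp⟩
    | insert x s hxs hmin ih =>
      intro hse
      rw [Finset.coe_insert, Set.insert_subset_iff] at hse
      rw [Finset.coe_insert, Set.image_insert_eq]
      have hlt : ∀ y ∈ s, S.partH x < S.partH y := fun y hy => (hmin y hy).lt_of_ne fun h =>
        hxs (S.edges_crossing e he hse.1 (hse.2 hy) h ▸ hy)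
      rcases s.eq_empty_or_nonempty with rfl | ⟨y, hy⟩
      · have := S.no_isolated (φ x)
        simp only [Hypergraph.IsIsolated, not_forall, not_not] at this
        obtain ⟨g, hg, hxg⟩ := this
        exact ⟨g, hg, by simpa using hxg⟩
      · have hx : (S.partH x : ℕ) + 1 < K := by
          have h1 : (S.partH x : ℕ) < S.partH y := hlt y hy
          have h2 := (S.partH y).isLt
          omega
        have hmem := hφ x hx
        simp only [nbhd, Finset.mem_filter] at hmem
        refine (hmem.2.2 (φ '' s) ⟨?_, ih hse.2⟩).2
        rintro _ ⟨z, hz, rfl⟩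
        obtain ⟨j, hj⟩ := S.f_covers x hx ⟨⟨e, he, hse.1, hse.2 hz⟩, hlt z hz⟩
        exact ⟨j, by simp [hj]⟩
  have hfin : e.Finite := Set.toFinite e
  have h1 := key hfin.toFinset (by simp)
  rw [hfin.coe_toFinset] at h1
  exact S.uniform_G.mem_edgeSet_of_mem_partialEdges (by omega) h1
    (by rw [Set.ncard_image_of_injective _ hinj, hek])

/-- If V_i is empty and W_i is not, every defect there is ∞. By induction from the last part 𝒬_x is
nonempty, so μ_{4d} = ∞. -/
theorem V_nonempty
    (hlast : ∀ i : Fin K, (i : ℕ) + 1 = K → 2 * (S.Wpart i).card ≤ (S.V i).card)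
    (hμ : 2 ^ (2 * d + 2) * S.gamma ^ (2 * d) * S.mu (4 * d) *
      ∑ i ∈ S.nonLast, ((S.Wpart i).card : ℝ≥0∞) / ENNReal.ofReal (S.θ i) < 1) (x : W) :
    (S.V (S.partH x)).Nonempty := by
  have hd := S.one_le_d
  induction x using (InvImage.wf S.partH (wellFounded_gt (α := Fin K))).induction with
  | _ x ih =>
  have hW : (S.Wpart (S.partH x)).card ≠ 0 :=
    Finset.card_ne_zero_of_mem (S.mem_Wpart.2 rfl)
  by_cases hx : (S.partH x : ℕ) + 1 < K
  swap
  · have h1 := hlast (S.partH x) (by have := (S.partH x).isLt; omega)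
    exact Finset.card_pos.1 (by omega)
  by_contra hV
  rw [Finset.not_nonempty_iff_eq_empty] at hV
  have hdef (Q : Set U) : S.defect Q (S.partH x) = ⊤ := by
    have : S.nbhd Q (S.partH x) = ∅ := by
      rw [← Finset.subset_empty, ← hV]
      exact S.nbhd_subset_V _ _
    simp [defect, this, omegaFun]
  have hT : (S.tuples x).Nonempty := Fintype.piFinset_nonempty.2 fun j => ih _ (S.f_later x hx j)
  have hmu : S.mu (4 * d) = ⊤ := by
    refine top_unique (le_trans (le_of_eq ?_)
      (Finset.le_sup (f := fun x => S.muAt (4 * d) x) (Finset.mem_univ x)))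
    have hT0 : ((S.tuples x).card : ℝ≥0∞) ≠ 0 := by simpa using hT.ne_empty
    simp only [muAt, if_pos hx, avgDefect, hdef, ENNReal.top_pow (show 4 * d ≠ 0 by omega),
      Finset.sum_const, nsmul_eq_mul, ENNReal.mul_top hT0]
    rw [ENNReal.top_div_of_ne_top (by finiteness)]
  have hγ : S.gamma ^ (2 * d) ≠ 0 :=
    pow_ne_zero _ (zero_lt_one.trans_le (le_max_left _ _)).ne'
  have hsum : ∑ i ∈ S.nonLast, ((S.Wpart i).card : ℝ≥0∞) / ENNReal.ofReal (S.θ i) ≠ 0 := by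
    rw [Ne, Finset.sum_eq_zero_iff]
    intro h
    have := h _ (S.mem_nonLast.2 hx)
    rw [ENNReal.div_eq_zero_iff] at this
    rcases this with h | h
    · exact hW (by exact_mod_cast h)
    · exact ENNReal.ofReal_ne_top h
  -- The factors multiplied with ∞ are nonzero, so the convention 0·∞ = 0 does not intervene.
  rw [hmu, ENNReal.mul_top (mul_ne_zero (by positivity) hγ), ENNReal.top_mul hsum] at hμ
  exact absurd hμ (by simp)

/-! ### Outcomes with small total defect are embeddings. -/

/-- The sets `A x` stand for V_K in the last part and for the neighbourhoods elsewhere. The offset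
`c` bounds the number of vertices used before the list starts and lets the induction pass to the
tail. -/
theorem listPMF_mem_and_injOn (hne : ∀ x ψ, (S.choices x ψ).Nonempty) (i : Fin K) (A : W → Finset U)
    (l : List W) (c : ℕ) {ψ ψ' : W → Option U} (hnd : l.Nodup) (hl : ∀ x ∈ l, S.partH x = i)
    (hc : (S.used i ψ).card ≤ c)
    (hA : ∀ m (hm : m < l.length) ψ₁, (∀ y, i < S.partH y → ψ₁ y = ψ y) →
      (S.used i ψ₁).card ≤ c + m → ∀ u ∈ S.choices l[m] ψ₁, u ∈ A l[m] ∧ u ∉ S.used i ψ₁)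
    (hψ' : ψ' ∈ (S.listPMF l ψ).support) (hset : ∀ x ∈ l, ψ x = none) :
    (∀ x ∈ l, ∃ u ∈ A x, ψ' x = some u ∧ u ∉ S.used i ψ) ∧
      ∀ x ∈ l, ∀ y ∈ l, ψ' x = ψ' y → x = y := by
  classical
  induction l generalizing ψ c with
  | nil => simp
  | cons x l ih =>
    rw [listPMF, PMF.mem_support_bind_iff] at hψ'
    obtain ⟨ψ₁, h1, h2⟩ := hψ'
    obtain ⟨u, hu, rfl⟩ := S.exists_of_mem_support_stepPMF (hne x ψ) h1
    have hux := hA 0 (by simp) ψ (fun _ _ => rfl) (by simpa using hc) u hu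
    rw [List.nodup_cons] at hnd
    have hx : S.partH x = i := hl x (by simp)
    have hlater : ∀ y, i < S.partH y → Function.update ψ x (some u) y = ψ y := fun y hy =>
      Function.update_of_ne (by rintro rfl; exact absurd hx hy.ne') _ _
    have hused : S.used i (Function.update ψ x (some u)) = insert u (S.used i ψ) := by
      ext v
      simp only [used, Finset.mem_filter, Finset.mem_univ, true_and, Finset.mem_insert]
      constructor
      · rintro ⟨y, hy, hv⟩
        by_cases hyx : y = x
        · subst hyx
          left
          simpa using hv.symm
        · rw [Function.update_of_ne hyx] at hv
          exact Or.inr ⟨y, hy, hv⟩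
      · rintro (rfl | ⟨y, hy, hv⟩)
        · exact ⟨x, hx, by simp⟩
        · refine ⟨y, hy, ?_⟩
          rwa [Function.update_of_ne]
          rintro rfl
          rw [hset _ (by simp)] at hv
          simp at hv
    obtain ⟨h3, h4⟩ := ih (c + 1) hnd.2 (fun y hy => hl y (by simp [hy]))
      (by rw [hused]; exact (Finset.card_insert_le _ _).trans (by omega))
      (fun m hm ψ₁ h5 h6 => hA (m + 1) (by simpa using hm) ψ₁
        (fun y hy => (h5 y hy).trans (hlater y hy)) (by omega)) h2
      (fun y hy => by
        rw [Function.update_of_ne (by rintro rfl; exact hnd.1 hy)]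
        exact hset y (by simp [hy]))
    have hψx : ψ' x = some u := by
      rw [(S.mem_support_listPMF hne l h2).1 x hnd.1, Function.update_self]
    have hdiff : ∀ y ∈ l, ψ' x ≠ ψ' y := by
      intro y hy h
      obtain ⟨v, -, hv, hv'⟩ := h3 y hy
      rw [hψx, hv, Option.some_inj] at h
      rw [hused] at hv'
      exact hv' (by simp [h])
    refine ⟨fun y hy => ?_, fun y hy z hz hyz => ?_⟩
    · rcases List.mem_cons.1 hy with rfl | hy
      · exact ⟨u, hux.1, hψx, hux.2⟩
      · obtain ⟨v, hvA, hv, hv'⟩ := h3 y hy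
        rw [hused, Finset.mem_insert, not_or] at hv'
        exact ⟨v, hvA, hv, hv'.2⟩
    · rcases List.mem_cons.1 hy with rfl | hy' <;> rcases List.mem_cons.1 hz with rfl | hz'
      · rfl
      · exact absurd hyz (hdiff z hz')
      · exact absurd hyz.symm (hdiff y hy')
      · exact h4 y hy' z hz' hyz

/-- If the total defect of a part is small and its vertices are taken in the order of non-increasing
defects, then the neighbourhoods are large in comparison with the positions in the order. -/
theorem two_mul_le_card_nbhd {i : Fin K} (hi : (i : ℕ) + 1 < K)
    (hθ : 2 * ((S.Wpart i).card : ℝ) ≤ S.θ i) {ψ : W → Option U} {l : List W} (hnd : l.Nodup)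
    (hmem : ∀ x, x ∈ l ↔ S.partH x = i)
    (hanti : l.Pairwise fun x y => S.defect (S.imageTuple y ψ) i ≤ S.defect (S.imageTuple x ψ) i)
    (hsum : 2 * ∑ x ∈ S.Wpart i, S.vertexDefect x ψ < ENNReal.ofReal (S.θ i)) (m : ℕ)
    (hm : m < l.length) :
    (S.nbhd (S.imageTuple l[m] ψ) i).card ≠ 0 ∧
      2 * m ≤ (S.nbhd (S.imageTuple l[m] ψ) i).card := by
  classical
  have hW : S.Wpart i = l.toFinset := by
    ext x
    rw [S.mem_Wpart, List.mem_toFinset, hmem]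
  have hcard : (S.Wpart i).card = l.length := by rw [hW, List.toFinset_card_of_nodup hnd]
  have hsum' : ∑ x ∈ S.Wpart i, S.vertexDefect x ψ =
      (l.map fun x => S.defect (S.imageTuple x ψ) i).sum := by
    rw [hW, List.sum_toFinset _ hnd]
    congr 1
    refine List.map_congr_left fun x hx => ?_
    obtain rfl := (hmem x).1 hx
    simp [vertexDefect, hi]
  set N := (S.nbhd (S.imageTuple l[m] ψ) i).card with hN
  set δ := S.defect (S.imageTuple l[m] ψ) i with hδ
  have hδN : δ = omegaFun (S.θ i) N := rfl
  -- The vertices at positions 0, …, m all have defect at least δ. Counting m + 1 of them, not m,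
  -- also excludes an empty neighbourhood at m = 0.
  have hbound : (m + 1 : ℕ) * δ ≤ ∑ x ∈ S.Wpart i, S.vertexDefect x ψ := by
    rw [hsum', ← List.sum_take_add_sum_drop _ (m + 1)]
    refine le_add_right ?_
    have h1 := List.card_nsmul_le_sum
      ((l.map fun x => S.defect (S.imageTuple x ψ) i).take (m + 1)) δ (fun a ha => ?_)
    · rw [nsmul_eq_mul, List.length_take, List.length_map, min_eq_left (by omega)] at h1
      exact h1
    · obtain ⟨j, hj, rfl⟩ := List.mem_iff_getElem.1 ha
      simp only [List.length_take, List.length_map] at hj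
      simp only [List.getElem_take, List.getElem_map]
      rcases (show j ≤ m by omega).eq_or_lt with rfl | hjm
      · exact le_rfl
      · exact List.pairwise_iff_getElem.1 hanti j m (by omega) hm hjm
  have hlt : 2 * ((m + 1 : ℕ) * δ) < ENNReal.ofReal (S.θ i) := lt_of_le_of_lt (by gcongr) hsum
  have hN0 : N ≠ 0 := by
    intro h0
    rw [hδN, h0] at hlt
    simp [omegaFun] at hlt
  refine ⟨hN0, ?_⟩
  have hNpos : (0 : ℝ) < N := by positivity
  rcases lt_or_ge (N : ℝ) (S.θ i) with h | h
  · rw [hδN, omegaFun, if_neg hNpos.ne', if_pos h] at hlt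
    have hθpos := S.θ_pos i hi
    have h2 : (2 : ℝ≥0∞) * ((m + 1 : ℕ) * ENNReal.ofReal (S.θ i / N)) =
        ENNReal.ofReal (2 * ((m + 1 : ℕ) * (S.θ i / N))) := by
      rw [ENNReal.ofReal_mul (by norm_num), ENNReal.ofReal_mul (by positivity),
        ENNReal.ofReal_natCast, ENNReal.ofReal_ofNat]
    rw [h2, ENNReal.ofReal_lt_ofReal_iff hθpos] at hlt
    have h3 : 2 * ((m + 1 : ℕ) : ℝ) * S.θ i < N * S.θ i := by
      have := mul_lt_mul_of_pos_right hlt hNpos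
      field_simp at this ⊢
      linarith
    have h4 := lt_of_mul_lt_mul_right h3 hθpos.le
    have h5 : 2 * (m + 1) < N := by exact_mod_cast h4
    omega
  · have h1 : (2 * (S.Wpart i).card : ℝ) ≤ N := hθ.trans h
    have h2 : 2 * (S.Wpart i).card ≤ N := by exact_mod_cast h1
    omega

/-- The part `W_i` is embedded injectively into `V_i`, and into the prescribed neighbourhoods. -/
structure PartEmbedded (i : Fin K) (ψ : W → Option U) : Prop where
  mem_V : ∀ x u, S.partH x = i → ψ x = some u → u ∈ S.V i
  mem_nbhd : (i : ℕ) + 1 < K → ∀ x u, S.partH x = i → ψ x = some u →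
    u ∈ S.nbhd (S.imageTuple x ψ) i
  inj : ∀ x y, S.partH x = i → S.partH y = i → ψ x = ψ y → x = y

variable {S}

theorem PartEmbedded.congr {i : Fin K} {ψ ψ' : W → Option U} (h : S.PartEmbedded i ψ)
    (hψ : ∀ y, i ≤ S.partH y → ψ' y = ψ y) : S.PartEmbedded i ψ' where
  mem_V x u hx hu := h.mem_V x u hx (hψ x hx.ge ▸ hu)
  mem_nbhd hi x u hx hu := by
    subst hx
    rw [S.imageTuple_congr fun j => hψ _ (S.f_later x hi j).le]
    exact h.mem_nbhd hi x u rfl (hψ x le_rfl ▸ hu)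
  inj x y hx hy hxy := h.inj x y hx hy (by rwa [hψ x hx.ge, hψ y hy.ge] at hxy)

theorem partEmbedded_of_mem_support_listPMF (hne : ∀ x ψ, (S.choices x ψ).Nonempty)
    (hθ : ∀ i : Fin K, (i : ℕ) + 1 < K → 2 * ((S.Wpart i).card : ℝ) ≤ S.θ i)
    {ord : Fin K → (W → Option U) → List W} (hord : S.IsOrderRule ord) {i : Fin K}
    {ψ ψ' : W → Option U} (hψ : ∀ x, S.partH x = i → ψ x = none)
    (hψ' : ψ' ∈ (S.listPMF (ord i ψ) ψ).support)
    (hsum : (i : ℕ) + 1 < K →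
      2 * ∑ x ∈ S.Wpart i, S.vertexDefect x ψ < ENNReal.ofReal (S.θ i)) :
    S.PartEmbedded i ψ' := by
  classical
  have hused : (S.used i ψ).card ≤ 0 := by
    simpa using S.card_used_le i ψ ∅ fun y hy h => absurd (hψ y hy) h
  have hmem := hord.mem_iff i ψ
  have hframe := (S.mem_support_listPMF hne _ hψ').1
  by_cases hi : (i : ℕ) + 1 < K
  · have hA : ∀ m (hm : m < (ord i ψ).length) ψ₁, (∀ y, i < S.partH y → ψ₁ y = ψ y) →
        (S.used i ψ₁).card ≤ 0 + m → ∀ u ∈ S.choices (ord i ψ)[m] ψ₁,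
        u ∈ S.nbhd (S.imageTuple (ord i ψ)[m] ψ) i ∧ u ∉ S.used i ψ₁ := by
      intro m hm ψ₁ h3 h4 u hu
      obtain ⟨h5, h6⟩ := S.two_mul_le_card_nbhd hi (hθ i hi) (hord.nodup i ψ) hmem
        (hord.antitone i ψ hi) (hsum hi) m hm
      have hx : S.partH (ord i ψ)[m] = i := (hmem _).1 (List.getElem_mem hm)
      have him : S.imageTuple (ord i ψ)[m] ψ₁ = S.imageTuple (ord i ψ)[m] ψ :=
        S.imageTuple_congr fun j => h3 _ (by
          have := S.f_later (ord i ψ)[m] (by rw [hx]; exact hi) j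
          rwa [hx] at this)
      have h7 := Finset.le_card_sdiff (S.used i ψ₁) (S.nbhd (S.imageTuple (ord i ψ)[m] ψ) i)
      simp only [choices, hx, if_pos hi, him, if_neg h5] at hu
      -- At most m vertices are used and 2m ≤ |N|, so |L| ≥ |N|/2 and the choice is made from L.
      rw [if_neg (by omega)] at hu
      exact Finset.mem_sdiff.1 hu
    obtain ⟨h1, h2⟩ := S.listPMF_mem_and_injOn hne i (fun x => S.nbhd (S.imageTuple x ψ) i) _ 0
      (hord.nodup i ψ) (fun x hx => (hmem x).1 hx) hused hA hψ'
      (fun x hx => hψ x ((hmem x).1 hx))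
    have hN : ∀ x u, S.partH x = i → ψ' x = some u → u ∈ S.nbhd (S.imageTuple x ψ') i := by
      intro x u hx hu
      obtain ⟨v, hv, hv', -⟩ := h1 x ((hmem x).2 hx)
      rw [hu, Option.some_inj] at hv'
      subst hv' hx
      rw [S.imageTuple_congr (ψ := ψ) fun j => hframe _
        (mt (hmem _).1 (S.f_later x hi j).ne')]
      exact hv
    exact ⟨fun x u hx hu => S.nbhd_subset_V _ _ (hN x u hx hu), fun _ => hN,
      fun x y hx hy => h2 x ((hmem x).2 hx) y ((hmem y).2 hy)⟩
  · have hA : ∀ m (hm : m < (ord i ψ).length) ψ₁, (∀ y, i < S.partH y → ψ₁ y = ψ y) →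
        (S.used i ψ₁).card ≤ 0 + m → ∀ u ∈ S.choices (ord i ψ)[m] ψ₁,
        u ∈ S.V i ∧ u ∉ S.used i ψ₁ := by
      intro m hm ψ₁ h3 h4 u hu
      have hx : S.partH (ord i ψ)[m] = i := (hmem _).1 (List.getElem_mem hm)
      simp only [choices, hx, if_neg hi] at hu
      exact Finset.mem_sdiff.1 hu
    obtain ⟨h1, h2⟩ := S.listPMF_mem_and_injOn hne i (fun _ => S.V i) _ 0
      (hord.nodup i ψ) (fun x hx => (hmem x).1 hx) hused hA hψ'
      (fun x hx => hψ x ((hmem x).1 hx))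
    refine ⟨fun x u hx hu => ?_, fun h => absurd h hi,
      fun x y hx hy => h2 x ((hmem x).2 hx) y ((hmem y).2 hy)⟩
    obtain ⟨v, hv, hv', -⟩ := h1 x ((hmem x).2 hx)
    rw [hu, Option.some_inj] at hv'
    exact hv' ▸ hv

theorem partEmbedded_of_mem_support_partsPMF (hne : ∀ x ψ, (S.choices x ψ).Nonempty)
    (hθ : ∀ i : Fin K, (i : ℕ) + 1 < K → 2 * ((S.Wpart i).card : ℝ) ≤ S.θ i)
    {ord : Fin K → (W → Option U) → List W} (hord : S.IsOrderRule ord) (l : List (Fin K))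
    {ψ ψ' : W → Option U} (h : S.Pending l ψ) (hψ' : ψ' ∈ (S.partsPMF ord l ψ).support)
    (hsum : ∀ i : Fin K, (i : ℕ) + 1 < K →
      2 * ∑ x ∈ S.Wpart i, S.vertexDefect x ψ' < ENNReal.ofReal (S.θ i)) :
    ∀ i ∈ l, S.PartEmbedded i ψ' := by
  induction l generalizing ψ with
  | nil => simp
  | cons i l ih =>
    have hframe := (mem_support_partsPMF hne hord _ h hψ').2
    rw [partsPMF, PMF.mem_support_bind_iff] at hψ'
    obtain ⟨ψ₁, h1, h2⟩ := hψ'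
    have htail := h.tail hne (hord.mem_iff i ψ) h1
    have hgt := (List.pairwise_cons.1 h.sorted).1
    intro j hj
    rcases List.mem_cons.1 hj with rfl | hj
    · refine PartEmbedded.congr (partEmbedded_of_mem_support_listPMF hne hθ hord
        (fun x hx => (h.eq_none_iff x).2 (by simp [hx])) h1 fun hi => ?_) fun y hy =>
          (mem_support_partsPMF hne hord _ htail h2).2 y fun hm => absurd (hgt _ hm) (not_lt.2 hy)
      -- The bound is known for the final state; the defects of this part already had their final
      -- values when its treatment began.
      convert hsum j hi using 2
      refine Finset.sum_congr rfl fun x hx => ?_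
      obtain rfl := S.mem_Wpart.1 hx
      refine (S.vertexDefect_congr fun y hy => hframe y ?_).symm
      exact fun hm => h.later hy ((h.eq_none_iff y).2 hm)
    · exact ih htail h2 j hj

/-! ### The first moment argument and the existence of an admissible order. -/

theorem exists_isEmbedding_of_isOrderRule
    (hlast : ∀ i : Fin K, (i : ℕ) + 1 = K → 2 * (S.Wpart i).card ≤ (S.V i).card)
    (hθ : ∀ i : Fin K, (i : ℕ) + 1 < K → 2 * ((S.Wpart i).card : ℝ) ≤ S.θ i)
    (hμ : 2 ^ (2 * d + 2) * S.gamma ^ (2 * d) * S.mu (4 * d) *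
      ∑ i ∈ S.nonLast, ((S.Wpart i).card : ℝ≥0∞) / ENNReal.ofReal (S.θ i) < 1)
    {ord : Fin K → (W → Option U) → List W} (hord : S.IsOrderRule ord) :
    ∃ φ : W → U, S.H.IsEmbedding S.G φ ∧ 0 < S.greedyPMF ord fun x => some (φ x) := by
  have hV := S.V_nonempty hlast hμ
  have hne := S.choices_nonempty hlast hV
  -- Normalising by θ_i handles all parts at once: an outcome where the sum is below 1 has every
  -- summand below 1.
  have hE : ((S.greedyPMF ord).lexpect fun ψ => ∑ i ∈ S.nonLast,
      (ENNReal.ofReal (S.θ i))⁻¹ * (2 * ∑ x ∈ S.Wpart i, S.vertexDefect x ψ)) < 1 := by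
    refine lt_of_le_of_lt ?_ hμ
    rw [PMF.lexpect_finset_sum, Finset.mul_sum]
    refine Finset.sum_le_sum fun i _ => ?_
    rw [PMF.lexpect_const_mul, PMF.lexpect_const_mul, PMF.lexpect_finset_sum, Finset.mul_sum]
    calc _ ≤ (ENNReal.ofReal (S.θ i))⁻¹ * ∑ x ∈ S.Wpart i,
          2 ^ (2 * d + 2) * S.gamma ^ (2 * d) * S.mu (4 * d) := by
          refine mul_le_mul' le_rfl ?_
          exact Finset.sum_le_sum fun x _ => lexpect_vertexDefect_le hlast hV hord x
      _ = _ := by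
          rw [Finset.sum_const, nsmul_eq_mul, div_eq_mul_inv]
          ring
  obtain ⟨ψ, hψ, hlt⟩ := PMF.exists_mem_support_lt hE
  have hsum : ∀ i : Fin K, (i : ℕ) + 1 < K →
      2 * ∑ x ∈ S.Wpart i, S.vertexDefect x ψ < ENNReal.ofReal (S.θ i) := by
    intro i hi
    have hθ0 : ENNReal.ofReal (S.θ i) ≠ 0 := by simpa using S.θ_pos i hi
    have h1 := lt_of_le_of_lt (Finset.single_le_sum (f := fun i => (ENNReal.ofReal (S.θ i))⁻¹ *
      (2 * ∑ x ∈ S.Wpart i, S.vertexDefect x ψ)) (fun _ _ => zero_le)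
      (S.mem_nonLast.2 hi)) hlt
    rw [mul_comm, ← div_eq_mul_inv, ENNReal.div_lt_iff (.inl hθ0) (.inl ENNReal.ofReal_ne_top),
      one_mul] at h1
    exact h1
  choose φ hφ using fun x => Option.ne_none_iff_exists'.1
    (ne_none_of_mem_support_greedyPMF hne hord hψ x)
  obtain rfl : ψ = fun x => some (φ x) := funext hφ
  have hemb (i : Fin K) : S.PartEmbedded i fun x => some (φ x) :=
    partEmbedded_of_mem_support_partsPMF hne hθ hord _ pending_finRange hψ hsum i (by simp)
  refine ⟨φ, S.isEmbedding_of_mem_nbhd (fun x y hxy => ?_)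
    fun x hx => (hemb _).mem_nbhd hx x _ rfl rfl, (PMF.apply_pos_iff _ _).2 hψ⟩
  have h1 := S.mem_V.1 ((hemb _).mem_V x _ rfl rfl)
  have h2 := S.mem_V.1 ((hemb _).mem_V y _ rfl rfl)
  exact (hemb (S.partH x)).inj x y rfl (by rw [← h1, ← h2, hxy]) (congrArg some hxy)

variable (S)

theorem exists_isOrderRule : ∃ ord : Fin K → (W → Option U) → List W, S.IsOrderRule ord := by
  classical
  let r (i : Fin K) (ψ : W → Option U) (x y : W) : Prop :=
    S.defect (S.imageTuple y ψ) i ≤ S.defect (S.imageTuple x ψ) i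
  refine ⟨fun i ψ => (S.Wpart i).toList.insertionSort (r i ψ), fun i ψ => ?_, fun i ψ x => ?_,
    fun i ψ _ => ?_⟩
  · exact (List.perm_insertionSort _ _).nodup_iff.2 (Finset.nodup_toList _)
  · rw [List.mem_insertionSort, Finset.mem_toList, S.mem_Wpart]
  · have : Std.Total (r i ψ) := ⟨fun x y => le_total _ _⟩
    have : IsTrans W (r i ψ) := ⟨fun x y z h1 h2 => le_trans h2 h1⟩
    exact List.pairwise_insertionSort _ _

end PartitionedPair

theorem theorem5p9 {U W : Type*} [Fintype U] [Fintype W] {k K d : ℕ}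
    (S : PartitionedPair U W k K d)
    (hlast : ∀ i : Fin K, (i : ℕ) + 1 = K → 2 * (S.Wpart i).card ≤ (S.V i).card)
    (hθ : ∀ i : Fin K, (i : ℕ) + 1 < K → 2 * ((S.Wpart i).card : ℝ) ≤ S.θ i)
    (hμ : 2 ^ (2 * d + 2) * S.gamma ^ (2 * d) * S.mu (4 * d) *
      ∑ i ∈ S.nonLast, ((S.Wpart i).card : ℝ≥0∞) / ENNReal.ofReal (S.θ i) < 1) :
    (∃ φ : W → U, S.H.IsEmbedding S.G φ) ∧
      ∀ ord : Fin K → (W → Option U) → List W, S.IsOrderRule ord →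
        ∃ φ : W → U, S.H.IsEmbedding S.G φ ∧ 0 < S.greedyPMF ord fun x => some (φ x) := by
  refine ⟨?_, fun ord hord => PartitionedPair.exists_isEmbedding_of_isOrderRule hlast hθ hμ hord⟩
  obtain ⟨ord, hord⟩ := S.exists_isOrderRule
  obtain ⟨φ, hφ, -⟩ := PartitionedPair.exists_isEmbedding_of_isOrderRule hlast hθ hμ hord
  exact ⟨φ, hφ⟩
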